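/- Model. Let $G=(V,E)$ be a finite directed graph without loops or parallel edges, with a source $s\in V$. A weight assignment is a function $\ell:E\to\mathbb Z$; only assignments without negative cycles are admitted as inputs. Every vertex $v$ carries a value $D[v]\in\mathbb Z\cup\{\infty\}$; initially $D[s]=0$ and, for $v\ne s$, $D[v]=\ell_{sv}$ if $(s,v)\in E$ and $D[v]=\infty$ otherwise. A deterministic algorithm on $G$ is a finite decision tree. Each internal node is either a D-query "$D[u]<D[v]$?" ($u,v\in V$) or a weight query "$\ell_{uv}<\ell_{xy}$?" ($(u,v),(x,y)\in E$), with a yes-branch and a no-branch, or a relaxation $D[v]\leftarrow\min\{D[v],D[u]+\ell_{uv}\}$ of an edge $(u,v)\in E$, with one branch; each leaf is a relaxation. The algorithm must be correct: for every $\ell$ without negative cycles, after the leaf has been executed every $D[v]$ equals the distance from $s$ to $v$ (the least length of a path from $s$ to $v$, or $\infty$ if there is none). Its running time on $\ell$ is the number of steps (queries and relaxations) performed until all $D[v]$ are equal to the distances from $s$, and its worst-case running time is the maximum of this over all $\ell$ without negative cycles. Theorem. There are a constant $c>0$ and, for all reals $\varepsilon,K>0$, a constant $c'(\varepsilon,K)>0$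 such that for all integers $n\ge 3$ and $m$ with $n\le m\le n(n-1)$ there is a directed graph with $n$ vertices and $m$ edges (no loops or parallel edges), with a source $s$, on which every correct deterministic algorithm using D-queries, weight queries and relaxations has worst-case running time at least $c\,nm/\log n$, and, for all $\varepsilon,K>0$ with $m\ge K n^{1+\varepsilon}$, at least $c'(\varepsilon,K)\,nm$. -/

import Mathlib

namespace ShortestPath

variable {V : Type*}

/-- The total weight of the consecutive pairs of a list of vertices. -/
def weight (ℓ : V → V → ℤ) : List V → ℤ
  | u :: v :: p => ℓ u v + weight ℓ (v :: p)
  | _ => 0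

/-- `p` lists the vertices of a walk from `x` to `y` in the digraph `G`. -/
def IsWalk (G : Digraph V) (x y : V) (p : List V) : Prop :=
  p.IsChain G.Adj ∧ p.head? = some x ∧ p.getLast? = some y

/-- A path is a walk that visits every vertex at most once. -/
def IsPath (G : Digraph V) (x y : V) (p : List V) : Prop :=
  IsWalk G x y p ∧ p.Nodup

/-- The weight assignment `ℓ` has no negative cycles in `G`. -/
def NoNegCycle (G : Digraph V) (ℓ : V → V → ℤ) : Prop :=
  ∀ (x : V) (p : List V), IsWalk G x x p → 0 ≤ weight ℓ p

/-- `d` is the distance from `x` to `y`, the least weight of a path from `x` to `y`;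
it is `⊤` if there is no such path. -/
def IsDist (G : Digraph V) (ℓ : V → V → ℤ) (x y : V) (d : WithTop ℤ) : Prop :=
  IsGLB {w : WithTop ℤ | ∃ p : List V, IsPath G x y p ∧ w = (weight ℓ p : ℤ)} d

/-- All D-values are equal to the distances from `s`. -/
def AllCorrect (G : Digraph V) (ℓ : V → V → ℤ) (s : V) (D : V → WithTop ℤ) : Prop :=
  ∀ v, IsDist G ℓ s v (D v)

open Classical in
/-- The initial D-values: `0` at `s`, and the weight of the edge `(s, v)` at `v ≠ s`,
which is `⊤` if `(s, v)` is not an edge. -/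
noncomputable def initD (G : Digraph V) (ℓ : V → V → ℤ) (s : V) : V → WithTop ℤ :=
  fun v => if v = s then 0 else if G.Adj s v then ((ℓ s v : ℤ) : WithTop ℤ) else ⊤

open Classical in
/-- The relaxation update `D[v] ← min {D[v], D[u] + ℓ u v}`. -/
noncomputable def relaxD (ℓ : V → V → ℤ) (u v : V) (D : V → WithTop ℤ) : V → WithTop ℤ :=
  Function.update D v (min (D v) (D u + ((ℓ u v : ℤ) : WithTop ℤ)))

/-- D-queries and weight queries. Weight queries compare the weights of two edges of `G`. -/
inductive Query (G : Digraph V) : Type _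
  /-- `D[u] < D[v]?` -/
  | dQuery (u v : V) : Query G
  /-- `ℓ u v < ℓ x y?` for edges `(u, v)` and `(x, y)` -/
  | weightQuery (u v x y : V) (huv : G.Adj u v) (hxy : G.Adj x y) : Query G

/-- The outcome of a query is "yes". -/
def Query.Holds {G : Digraph V} (ℓ : V → V → ℤ) (D : V → WithTop ℤ) : Query G → Prop
  | .dQuery u v => D u < D v
  | .weightQuery u v x y _ _ => ℓ u v < ℓ x y

/-- A deterministic query/relaxation algorithm on `G` with D-queries and weight queries:
a decision tree whose internal nodes are queries (with a "yes" and a "no" branch) or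
relaxations of edges of `G` (with one branch), and whose leaves are relaxations. -/
inductive Algorithm (G : Digraph V) : Type _
  | leaf (u v : V) (h : G.Adj u v) : Algorithm G
  | relax (u v : V) (h : G.Adj u v) (next : Algorithm G) : Algorithm G
  | query (q : Query G) (yes no : Algorithm G) : Algorithm G

namespace Algorithm

variable {G : Digraph V}

open Classical in
/-- The D-values after the first `t` steps (queries and relaxations each count as one step)
of the computation started with D-values `D`. After the leaf nothing changes any more. -/
noncomputable def valuesAfter (ℓ : V → V → ℤ) :
    Algorithm G → ℕ → (V → WithTop ℤ) → V → WithTop ℤ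
  | _, 0, D => D
  | leaf u v _, _ + 1, D => relaxD ℓ u v D
  | relax u v _ A, t + 1, D => valuesAfter ℓ A t (relaxD ℓ u v D)
  | query q A B, t + 1, D =>
      if q.Holds ℓ D then valuesAfter ℓ A t D else valuesAfter ℓ B t D

open Classical in
/-- The D-values when the computation started with D-values `D` has executed its leaf. -/
noncomputable def finalValues (ℓ : V → V → ℤ) :
    Algorithm G → (V → WithTop ℤ) → V → WithTop ℤ
  | leaf u v _, D => relaxD ℓ u v D
  | relax u v _ A, D => finalValues ℓ A (relaxD ℓ u v D)
  | query q A B, D => if q.Holds ℓ D then finalValues ℓ A D else finalValues ℓ B D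

/-- The algorithm computes all distances from `s`, for every weight assignment without
negative cycles. (Weights of pairs that are not edges of `G` are never used.) -/
def Correct (A : Algorithm G) (s : V) : Prop :=
  ∀ ℓ : V → V → ℤ, NoNegCycle G ℓ → AllCorrect G ℓ s (A.finalValues ℓ (initD G ℓ s))

/-- The running time on the weight assignment `ℓ`: the number of steps performed until all
D-values are equal to the distances from `s`. (For a correct algorithm and a weight assignment
without negative cycles this happens at the leaf at the latest.) -/
noncomputable def runningTime (A : Algorithm G) (s : V) (ℓ : V → V → ℤ) : ℕ :=
  sInf {t : ℕ | AllCorrect G ℓ s (A.valuesAfter ℓ t (initD G ℓ s))}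

end Algorithm

end ShortestPath

namespace ShortestPath

variable {V : Type*} {G : Digraph V}

/-- Executes a list of relaxations. -/
noncomputable def runList (ℓ : V → V → ℤ) (w : List (V × V)) (D : V → WithTop ℤ) :
    V → WithTop ℤ :=
  w.foldl (fun D e => relaxD ℓ e.1 e.2 D) D

namespace Algorithm

open Classical in
/-- The relaxations performed during the first `t` steps. -/
noncomputable def trace (ℓ : V → V → ℤ) :
    Algorithm G → ℕ → (V → WithTop ℤ) → List (V × V)
  | _, 0, _ => []
  | leaf u v _, _ + 1, _ => [(u, v)]
  | relax u v _ A, t + 1, D => (u, v) :: trace ℓ A t (relaxD ℓ u v D)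
  | query q A B, t + 1, D => if q.Holds ℓ D then trace ℓ A t D else trace ℓ B t D

/-- The height of the decision tree. -/
def depth : Algorithm G → ℕ
  | leaf _ _ _ => 1
  | relax _ _ _ A => A.depth + 1
  | query _ A B => max A.depth B.depth + 1

theorem valuesAfter_eq_runList (ℓ : V → V → ℤ) (A : Algorithm G) (t : ℕ)
    (D : V → WithTop ℤ) : A.valuesAfter ℓ t D = runList ℓ (A.trace ℓ t D) D := by
  induction A generalizing t D with
  | leaf u v h => cases t <;> simp [valuesAfter, trace, runList]
  | relax u v h A ih =>
    cases t with
    | zero => simp [valuesAfter, trace, runList]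
    | succ t => simp only [valuesAfter, trace, ih]; simp [runList]
  | query q A B ihA ihB =>
    cases t with
    | zero => simp [valuesAfter, trace, runList]
    | succ t =>
      simp only [valuesAfter, trace]
      split_ifs
      · exact ihA _ _
      · exact ihB _ _

theorem length_trace_le (ℓ : V → V → ℤ) (A : Algorithm G) (t : ℕ)
    (D : V → WithTop ℤ) : (A.trace ℓ t D).length ≤ t := by
  induction A generalizing t D with
  | leaf u v h => cases t <;> simp [trace]
  | relax u v h A ih =>
    cases t with
    | zero => simp [trace]
    | succ t => simpa [trace] using ih _ _
  | query q A B ihA ihB =>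
    cases t with
    | zero => simp [trace]
    | succ t =>
      simp only [trace]
      split_ifs
      · exact (ihA _ _).trans (Nat.le_succ t)
      · exact (ihB _ _).trans (Nat.le_succ t)

theorem trace_sublist (ℓ : V → V → ℤ) (A : Algorithm G) {t t' : ℕ} (h : t ≤ t')
    (D : V → WithTop ℤ) : (A.trace ℓ t D).Sublist (A.trace ℓ t' D) := by
  induction A generalizing t t' D with
  | leaf u v _ =>
    cases t with
    | zero => simp [trace]
    | succ t => cases t' with
      | zero => omega
      | succ t' => simp [trace]
  | relax u v _ A ih =>
    cases t with
    | zero => simp [trace]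
    | succ t => cases t' with
      | zero => omega
      | succ t' => simpa [trace] using ih (by omega) _
  | query q A B ihA ihB =>
    cases t with
    | zero => simp [trace]
    | succ t => cases t' with
      | zero => omega
      | succ t' =>
        simp only [trace]
        split_ifs
        · exact ihA (by omega) _
        · exact ihB (by omega) _

theorem valuesAfter_eq_finalValues (ℓ : V → V → ℤ) (A : Algorithm G) {t : ℕ}
    (h : A.depth ≤ t) (D : V → WithTop ℤ) : A.valuesAfter ℓ t D = A.finalValues ℓ D := by
  induction A generalizing t D with
  | leaf u v _ =>
    cases t with
    | zero => simp [depth] at h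
    | succ t => simp [valuesAfter, finalValues]
  | relax u v _ A ih =>
    cases t with
    | zero => simp [depth] at h
    | succ t => simpa [valuesAfter, finalValues] using ih (by simpa [depth] using h) _
  | query q A B ihA ihB =>
    cases t with
    | zero => simp [depth] at h
    | succ t =>
      simp only [depth, Nat.add_le_add_iff_right, max_le_iff] at h
      simp only [valuesAfter, finalValues]
      rw [ihA h.1, ihB h.2]

theorem allCorrect_runningTime {A : Algorithm G} {s : V} (hA : A.Correct s)
    {ℓ : V → V → ℤ} (hℓ : NoNegCycle G ℓ) :
    AllCorrect G ℓ s (A.valuesAfter ℓ (A.runningTime s ℓ) (initD G ℓ s)) := by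
  have hne : {t : ℕ | AllCorrect G ℓ s (A.valuesAfter ℓ t (initD G ℓ s))}.Nonempty :=
    ⟨A.depth, by
      simp only [Set.mem_ofPred_eq, A.valuesAfter_eq_finalValues ℓ le_rfl]
      exact hA ℓ hℓ⟩
  exact Nat.sInf_mem hne

end Algorithm

/-- The weights given by a potential `q` and a perturbation `δ`. -/
def potWeight (q : V → ℤ) (δ : V → V → ℤ) (u v : V) : ℤ := q v - q u + δ u v

theorem weight_potWeight (q : V → ℤ) (δ : V → V → ℤ) (hδ : ∀ u v, 0 ≤ δ u v) (x y : V)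
    (p : List V) (hx : p.head? = some x) (hy : p.getLast? = some y) :
    q y - q x ≤ weight (potWeight q δ) p := by
  induction p generalizing x with
  | nil => simp at hx
  | cons a p ih =>
    cases p with
    | nil =>
      simp only [List.head?_cons, Option.some.injEq, List.getLast?_singleton] at hx hy
      subst hx hy
      simp [weight]
    | cons b p =>
      have h1 := ih b (by simp) (by simpa using hy)
      have h2 := hδ a b
      simp only [List.head?_cons, Option.some.injEq] at hx
      subst hx
      simp only [weight]
      unfold potWeight at *
      omega

theorem noNegCycle_potWeight (G : Digraph V) (q : V → ℤ) (δ : V → V → ℤ)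
    (hδ : ∀ u v, 0 ≤ δ u v) : NoNegCycle G (potWeight q δ) := by
  intro x p hp
  have := weight_potWeight q δ hδ x x p hp.2.1 hp.2.2
  omega

/-- The finite values are those at vertices of `F`, and there they exceed the potential `q`
by at most `j`. -/
def Near (q : V → ℤ) (F : Set V) (j : ℤ) (D : V → WithTop ℤ) : Prop :=
  ∀ v, (v ∈ F ∧ ∃ e : ℤ, 0 ≤ e ∧ e ≤ j ∧ D v = ((q v + e : ℤ) : WithTop ℤ)) ∨
    (v ∉ F ∧ D v = ⊤)

/-- Potentials of distinct vertices, and potential differences along distinct edges,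
differ by at least `M`. -/
structure Separated (q : V → ℤ) (M : ℤ) : Prop where
  vert : ∀ u v, u ≠ v → M ≤ |q u - q v|
  edge : ∀ u v x y, u ≠ v → x ≠ y → (u, v) ≠ (x, y) → M ≤ |(q v - q u) - (q y - q x)|

theorem near_relaxD {q : V → ℤ} {F : Set V} {j : ℤ} {D : V → WithTop ℤ} (h : Near q F j D)
    {δ : V → V → ℤ} (hδ0 : ∀ u v, 0 ≤ δ u v) (hδ1 : ∀ u v, δ u v ≤ 1) (u v : V) :
    Near q (F ∪ {x | x = v ∧ u ∈ F}) (j + 1) (relaxD (potWeight q δ) u v D) := by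
  classical
  intro x
  have h0 := hδ0 u v
  have h1 := hδ1 u v
  by_cases hx : x = v
  · subst hx
    rcases h u with ⟨hu, e, he0, he1, he⟩ | ⟨hu, he⟩
    · left
      refine ⟨Or.inr ⟨rfl, hu⟩, ?_⟩
      have hs : D u + ((potWeight q δ u x : ℤ) : WithTop ℤ)
          = ((q x + (e + δ u x) : ℤ) : WithTop ℤ) := by
        rw [he, ← WithTop.coe_add]; congr 1; unfold potWeight; ring
      rcases h x with ⟨_, e', he0', he1', he'⟩ | ⟨_, he'⟩
      · refine ⟨min e' (e + δ u x), by omega, by omega, ?_⟩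
        simp only [relaxD, Function.update_self]
        rw [hs, he', ← WithTop.coe_min, min_add_add_left]
      · refine ⟨e + δ u x, by omega, by omega, ?_⟩
        simp only [relaxD, Function.update_self]
        rw [hs, he', min_eq_right le_top]
    · have hs : relaxD (potWeight q δ) u x D x = D x := by
        simp [relaxD, he]
      rw [hs]
      rcases h x with ⟨hx, e', he0', he1', he'⟩ | ⟨hx, he'⟩
      · exact Or.inl ⟨Or.inl hx, e', he0', by omega, he'⟩
      · exact Or.inr ⟨by simp [hx, hu], he'⟩
  · have hs : relaxD (potWeight q δ) u v D x = D x := by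
      simp [relaxD, Function.update_of_ne hx]
    rw [hs]
    rcases h x with ⟨hxF, e', he0', he1', he'⟩ | ⟨hxF, he'⟩
    · exact Or.inl ⟨Or.inl hxF, e', he0', by omega, he'⟩
    · exact Or.inr ⟨by simp [hxF, hx], he'⟩

theorem near_initD (G : Digraph V) {q : V → ℤ} {s : V} (hs : q s = 0)
    {δ : V → V → ℤ} (hδ0 : ∀ u v, 0 ≤ δ u v) (hδ1 : ∀ u v, δ u v ≤ 1) :
    Near q {v | v = s ∨ G.Adj s v} 1 (initD G (potWeight q δ) s) := by
  intro v
  unfold initD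
  by_cases hv : v = s
  · left
    exact ⟨Or.inl hv, 0, le_rfl, zero_le_one, by simp [hv, hs]⟩
  · by_cases ha : G.Adj s v
    · left
      refine ⟨Or.inr ha, δ s v, hδ0 s v, hδ1 s v, ?_⟩
      simp [hv, ha, potWeight, hs]
    · right
      simp [hv, ha]

theorem near_lt_iff {q : V → ℤ} {M j : ℤ} (hq : Separated q M) (hj : j < M) {F : Set V}
    {D D' : V → WithTop ℤ} (h : Near q F j D) (h' : Near q F j D') (u v : V) (huv : D u < D v) :
    D' u < D' v := by
  have hne : u ≠ v := by rintro rfl; exact lt_irrefl _ huv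
  have hsep := hq.vert u v hne
  rcases h u with ⟨hu, e, he0, he1, he⟩ | ⟨hu, he⟩
  · rcases h' u with ⟨_, a, ha0, ha1, ha⟩ | ⟨hu', _⟩
    · rcases h v with ⟨hv, f, hf0, hf1, hf⟩ | ⟨hv, hf⟩
      · rcases h' v with ⟨_, b, hb0, hb1, hb⟩ | ⟨hv', _⟩
        · rw [he, hf, WithTop.coe_lt_coe] at huv
          rw [ha, hb, WithTop.coe_lt_coe]
          rcases abs_cases (q u - q v) with ⟨h1, _⟩ | ⟨h1, _⟩ <;> omega
        · exact absurd hv hv'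
      · rcases h' v with ⟨hv', _⟩ | ⟨_, hb⟩
        · exact absurd hv' hv
        · rw [ha, hb]; exact WithTop.coe_lt_top _
    · exact absurd hu hu'
  · rw [he] at huv
    exact absurd huv not_top_lt

theorem potWeight_lt {q : V → ℤ} {M : ℤ} (hq : Separated q M) (hM : 1 < M)
    {δ δ' : V → V → ℤ} (hδ0 : ∀ u v, 0 ≤ δ u v) (hδ1 : ∀ u v, δ u v ≤ 1)
    (hδ0' : ∀ u v, 0 ≤ δ' u v) (hδ1' : ∀ u v, δ' u v ≤ 1) {u v x y : V} (huv : u ≠ v)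
    (hxy : x ≠ y) (h : potWeight q δ u v < potWeight q δ x y) :
    potWeight q δ' u v < potWeight q δ' x y := by
  have hne : (u, v) ≠ (x, y) := by
    intro he
    obtain ⟨rfl, rfl⟩ := Prod.mk.inj he
    exact lt_irrefl _ h
  have hsep := hq.edge u v x y huv hxy hne
  have a1 := hδ0 u v
  have a2 := hδ1 u v
  have a3 := hδ0' u v
  have a4 := hδ1' u v
  have b1 := hδ0 x y
  have b2 := hδ1 x y
  have b3 := hδ0' x y
  have b4 := hδ1' x y
  unfold potWeight at *
  rcases abs_cases ((q v - q u) - (q y - q x)) with ⟨h1, _⟩ | ⟨h1, _⟩ <;> omega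

/-- The outcomes of all queries, and hence the relaxations performed, do not depend on the
perturbation. -/
theorem Algorithm.trace_congr (hG : ∀ v, ¬ G.Adj v v) {q : V → ℤ} {M : ℤ}
    (hq : Separated q M) {δ δ' : V → V → ℤ}
    (hδ0 : ∀ u v, 0 ≤ δ u v) (hδ1 : ∀ u v, δ u v ≤ 1)
    (hδ0' : ∀ u v, 0 ≤ δ' u v) (hδ1' : ∀ u v, δ' u v ≤ 1) (A : Algorithm G) (t : ℕ)
    {F : Set V} {j : ℤ} (hj : 1 ≤ j) (hjM : j + A.depth < M) {D D' : V → WithTop ℤ}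
    (h : Near q F j D) (h' : Near q F j D') :
    A.trace (potWeight q δ) t D = A.trace (potWeight q δ') t D' := by
  induction A generalizing t F j D D' with
  | leaf u v _ => cases t <;> simp [trace]
  | relax u v _ A ih =>
    cases t with
    | zero => simp [trace]
    | succ t =>
      simp only [trace, List.cons.injEq, true_and]
      simp only [depth] at hjM
      push_cast at hjM
      exact ih t (by omega) (by omega) (near_relaxD h hδ0 hδ1 u v) (near_relaxD h' hδ0' hδ1' u v)
  | query Q A B ihA ihB =>
    cases t with
    | zero => simp [trace]
    | succ t =>
      simp only [depth] at hjM
      push_cast at hjM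
      have hiff : Q.Holds (potWeight q δ) D ↔ Q.Holds (potWeight q δ') D' := by
        cases Q with
        | dQuery u v =>
          exact ⟨near_lt_iff hq (by omega) h h' u v, near_lt_iff hq (by omega) h' h u v⟩
        | weightQuery u v x y huv hxy =>
          have h1 : u ≠ v := by rintro rfl; exact hG _ huv
          have h2 : x ≠ y := by rintro rfl; exact hG _ hxy
          exact ⟨potWeight_lt hq (by omega) hδ0 hδ1 hδ0' hδ1' h1 h2,
            potWeight_lt hq (by omega) hδ0' hδ1' hδ0 hδ1 h1 h2⟩
      simp only [trace]
      by_cases hQ : Q.Holds (potWeight q δ) D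
      · rw [if_pos hQ, if_pos (hiff.1 hQ)]
        exact ihA t hj (by omega) h h'
      · rw [if_neg hQ, if_neg (mt hiff.2 hQ)]
        exact ihB t hj (by omega) h h'

open Classical in
/-- The perturbation that is `0` on the first `k` edges of `p` and `1` elsewhere. -/
noncomputable def pathPert (k : ℕ) (p : ℕ → V) (u v : V) : ℤ :=
  if ∃ i < k, u = p i ∧ v = p (i + 1) then 0 else 1

theorem pathPert_nonneg (k : ℕ) (p : ℕ → V) (u v : V) : 0 ≤ pathPert k p u v := by
  unfold pathPert; split_ifs <;> simp

theorem pathPert_le_one (k : ℕ) (p : ℕ → V) (u v : V) : pathPert k p u v ≤ 1 := by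
  unfold pathPert; split_ifs <;> simp

theorem pathPert_eq_zero {k : ℕ} {p : ℕ → V} {u v : V} (h : pathPert k p u v = 0) :
    ∃ i < k, u = p i ∧ v = p (i + 1) := by
  unfold pathPert at h
  by_contra hc
  simp [hc] at h

theorem le_runList (G : Digraph V) {q : V → ℤ} {s : V} (hs : q s = 0) {δ : V → V → ℤ}
    (hδ0 : ∀ u v, 0 ≤ δ u v) (w : List (V × V)) (v : V) :
    ((q v : ℤ) : WithTop ℤ) ≤ runList (potWeight q δ) w (initD G (potWeight q δ) s) v := by
  classical
  induction w using List.reverseRecOn generalizing v with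
  | nil =>
    simp only [runList, List.foldl_nil, initD]
    have := hδ0 s v
    split_ifs with h1 h2
    · subst h1; simp [hs]
    · rw [WithTop.coe_le_coe]; unfold potWeight; omega
    · exact le_top
  | append_singleton w e ih =>
    simp only [runList, List.foldl_append, List.foldl_cons, List.foldl_nil] at ih ⊢
    generalize List.foldl (fun D e => relaxD (potWeight q δ) e.1 e.2 D)
      (initD G (potWeight q δ) s) w = D at ih
    unfold relaxD
    by_cases hv : v = e.2
    · subst hv
      rw [Function.update_self]
      refine le_min (ih _) ?_
      have h1 := hδ0 e.1 e.2
      have h2 := ih e.1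
      calc ((q e.2 : ℤ) : WithTop ℤ)
          ≤ ((q e.1 + potWeight q δ e.1 e.2 : ℤ) : WithTop ℤ) := by
            rw [WithTop.coe_le_coe]; unfold potWeight; omega
        _ = (q e.1 : WithTop ℤ) + (potWeight q δ e.1 e.2 : ℤ) := WithTop.coe_add _ _
        _ ≤ _ := by gcongr
    · rw [Function.update_of_ne hv]; exact ih v

/-- A vertex can have attained its potential only if it lies on the path and the relaxations
include the edges of the path up to it, in order. -/
theorem sublist_of_runList_eq (G : Digraph V) {q : V → ℤ} {s : V} (hs : q s = 0) {k : ℕ}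
    {p : ℕ → V} (hp0 : p 0 = s) (hinj : Set.InjOn p (Set.Iic k)) (w : List (V × V)) (v : V)
    (hv : runList (potWeight q (pathPert k p)) w (initD G (potWeight q (pathPert k p)) s) v
      = ((q v : ℤ) : WithTop ℤ)) :
    ∃ i ≤ k, v = p i ∧
      ((List.range i).map fun i => (p i, p (i + 1))).Sublist ((p 0, p 1) :: w) := by
  classical
  induction w using List.reverseRecOn generalizing v with
  | nil =>
    simp only [runList, List.foldl_nil, initD] at hv
    split_ifs at hv with h1 h2
    · exact ⟨0, Nat.zero_le _, by rw [h1, hp0], by simp⟩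
    · rw [WithTop.coe_inj] at hv
      have h0 : pathPert k p s v = 0 := by unfold potWeight at hv; omega
      obtain ⟨i, hi, hsi, hvi⟩ := pathPert_eq_zero h0
      have : i = 0 := hinj (by simp; omega) (by simp) (by rw [← hsi, hp0])
      subst this
      exact ⟨1, hi, hvi, by simp⟩
    · exact absurd hv.symm (WithTop.coe_ne_top)
  | append_singleton w e ih =>
    have hle := le_runList G hs (pathPert_nonneg k p) w
    simp only [runList, List.foldl_append, List.foldl_cons, List.foldl_nil] at ih hv hle
    generalize List.foldl (fun D e => relaxD (potWeight q (pathPert k p)) e.1 e.2 D)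
      (initD G (potWeight q (pathPert k p)) s) w = D at ih hv hle
    by_cases hD : D v = ((q v : ℤ) : WithTop ℤ)
    · obtain ⟨i, hi, hvi, hsub⟩ := ih v hD
      refine ⟨i, hi, hvi, hsub.trans ?_⟩
      rw [← List.cons_append]
      exact List.sublist_append_left _ _
    · unfold relaxD at hv
      have hve : v = e.2 := by
        by_contra hne
        rw [Function.update_of_ne hne] at hv
        exact hD hv
      subst hve
      rw [Function.update_self] at hv
      have hsum : D e.1 + ((potWeight q (pathPert k p) e.1 e.2 : ℤ) : WithTop ℤ)
          = ((q e.2 : ℤ) : WithTop ℤ) := by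
        rcases min_choice (D e.2)
          (D e.1 + ((potWeight q (pathPert k p) e.1 e.2 : ℤ) : WithTop ℤ)) with h | h
        · exact absurd (h.symm.trans hv) hD
        · exact h.symm.trans hv
      have h1 := hle e.1
      have h2 := pathPert_nonneg k p e.1 e.2
      obtain ⟨z, hz⟩ : ∃ z : ℤ, D e.1 = (z : WithTop ℤ) := by
        cases hDe : D e.1 with
        | top => rw [hDe] at hsum; simp at hsum
        | coe z => exact ⟨z, rfl⟩
      rw [hz, ← WithTop.coe_add, WithTop.coe_inj] at hsum
      rw [hz, WithTop.coe_le_coe] at h1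
      unfold potWeight at hsum
      have h0 : pathPert k p e.1 e.2 = 0 := by omega
      have hze : z = q e.1 := by omega
      obtain ⟨i, hi, hei, hsub⟩ := ih e.1 (by rw [hz, hze])
      obtain ⟨i', hi', hei', hei2⟩ := pathPert_eq_zero h0
      have hii : i = i' := hinj hi (by simp; omega) (by rw [← hei, hei'])
      subst hii
      refine ⟨i + 1, hi', hei2, ?_⟩
      rw [List.range_succ, List.map_append, ← List.cons_append]
      refine hsub.append ?_
      simp only [List.map_cons, List.map_nil]
      rw [← hei, ← hei2]

theorem weight_map_range' (q : V → ℤ) (δ : V → V → ℤ) (p : ℕ → V) (j k : ℕ)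
    (h : ∀ i, j ≤ i → i < j + k → δ (p i) (p (i + 1)) = 0) :
    weight (potWeight q δ) ((List.range' j (k + 1)).map p) = q (p (j + k)) - q (p j) := by
  induction k generalizing j with
  | zero => simp [weight]
  | succ k ih =>
    have h1 := ih (j + 1) (fun i hi hik => h i (by omega) (by omega))
    have h2 := h j le_rfl (by omega)
    rw [List.range'_succ, List.range'_succ] at *
    simp only [List.map_cons] at h1 ⊢
    simp only [weight, h1, potWeight, h2]
    rw [show j + 1 + k = j + (k + 1) by ring]
    ring

/-- If the algorithm needs at most `T` steps on every input, then a single sequence of at most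
`T` relaxations contains every simple path from the source, up to its first edge, as a
subsequence. -/
theorem exists_list_of_runningTime_le (hG : ∀ v, ¬ G.Adj v v) {s : V}
    (hsep : ∀ M : ℤ, 0 < M → ∃ q : V → ℤ, q s = 0 ∧ Separated q M)
    {A : Algorithm G} (hA : A.Correct s) {T : ℕ}
    (hT : ∀ ℓ, NoNegCycle G ℓ → A.runningTime s ℓ ≤ T) :
    ∃ w : List (V × V), w.length ≤ T ∧ ∀ (k : ℕ) (p : ℕ → V), p 0 = s →
      Set.InjOn p (Set.Iic k) → (∀ i < k, G.Adj (p i) (p (i + 1))) →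
      ((List.range k).map fun i => (p i, p (i + 1))).Sublist ((p 0, p 1) :: w) := by
  obtain ⟨q, hs, hq⟩ := hsep (A.depth + 2) (by positivity)
  refine ⟨A.trace (potWeight q fun _ _ => 0) T (initD G (potWeight q fun _ _ => 0) s),
    A.length_trace_le _ _ _, fun k p hp0 hinj hadj => ?_⟩
  set ℓ := potWeight q (pathPert k p) with hℓdef
  have hℓ : NoNegCycle G ℓ := noNegCycle_potWeight G q _ (pathPert_nonneg k p)
  have hc := Algorithm.allCorrect_runningTime hA hℓ (p k)
  rw [A.valuesAfter_eq_runList] at hc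
  have hpath : IsPath G s (p k) ((List.range (k + 1)).map p) := by
    refine ⟨⟨?_, ?_, ?_⟩, ?_⟩
    · rw [List.isChain_map]
      rw [List.isChain_iff_getElem]
      intro i hi
      simp only [List.length_range] at hi
      simpa using hadj i (by omega)
    · simp [List.range_succ_eq_map, hp0]
    · simp [List.range_succ]
    · refine List.Nodup.map_on ?_ List.nodup_range
      intro x hx y hy hxy
      simp only [List.mem_range] at hx hy
      exact hinj (by simp; omega) (by simp; omega) hxy
  have hw : weight ℓ ((List.range (k + 1)).map p) = q (p k) := by
    have := weight_map_range' q (pathPert k p) p 0 k (fun i _ hi => by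
      unfold pathPert; rw [if_pos ⟨i, by omega, rfl, rfl⟩])
    rw [List.range_eq_range', this, hp0, hs]
    simp
  have hle := hc.1 ⟨_, hpath, rfl⟩
  rw [hw] at hle
  have heq := le_antisymm hle (le_runList G hs (pathPert_nonneg k p) _ (p k))
  obtain ⟨i, hi, hki, hsub⟩ := sublist_of_runList_eq G hs hp0 hinj _ _ heq
  have : k = i := hinj (by simp) hi hki
  subst this
  refine hsub.trans (List.Sublist.cons_cons _ ?_)
  have htr : A.trace ℓ (A.runningTime s ℓ) (initD G ℓ s)
      = A.trace (potWeight q fun _ _ => 0) (A.runningTime s ℓ)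
          (initD G (potWeight q fun _ _ => 0) s) :=
    A.trace_congr hG hq (pathPert_nonneg k p) (pathPert_le_one k p) (fun _ _ => le_rfl)
      (fun _ _ => zero_le_one) _ le_rfl (by omega)
      (near_initD G hs (pathPert_nonneg k p) (pathPert_le_one k p))
      (near_initD G hs (fun _ _ => le_rfl) (fun _ _ => zero_le_one))
  rw [htr]
  exact A.trace_sublist _ (hT ℓ hℓ) _

theorem three_pow_add_inj {a b c d : ℕ} (hab : a ≠ b) (h : 3 ^ a + 3 ^ d = 3 ^ c + 3 ^ b) :
    a = c ∧ b = d := by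
  have key : ∀ x y : ℕ, x < y → 3 * 3 ^ x ≤ 3 ^ y := fun x y hxy => by
    rw [← pow_succ']; exact Nat.pow_le_pow_right (by norm_num) hxy
  have pos : ∀ x : ℕ, 0 < 3 ^ x := fun x => by positivity
  have := pos a
  have := pos b
  have := pos c
  have := pos d
  have hac : a = c := by
    rcases lt_trichotomy a c with hlt | heq | hlt
    · have := key _ _ hlt
      rcases lt_trichotomy c d with h1 | rfl | h1
      · have := key _ _ h1
        rcases lt_trichotomy b d with h2 | rfl | h2
        · have := key _ _ h2; omega
        · omega
        · have := key _ _ h2; omega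
      · have hb : b = a := by
          apply Nat.pow_right_injective (by norm_num : 2 ≤ 3)
          simp only
          omega
        omega
      · have := key _ _ h1; omega
    · exact heq
    · have := key _ _ hlt
      rcases lt_trichotomy a b with h1 | rfl | h1
      · have := key _ _ h1
        rcases lt_trichotomy b d with h2 | rfl | h2
        · have := key _ _ h2; omega
        · omega
        · have := key _ _ h2; omega
      · exact absurd rfl hab
      · have := key _ _ h1; omega
  subst hac
  refine ⟨rfl, ?_⟩
  apply Nat.pow_right_injective (by norm_num : 2 ≤ 3)
  simp only
  omega

theorem exists_separated {n : ℕ} (s : Fin n) (M : ℤ) (hM : 0 < M) :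
    ∃ q : Fin n → ℤ, q s = 0 ∧ Separated q M := by
  have mul_le : ∀ x : ℤ, x ≠ 0 → M ≤ |M * x| := fun x hx => by
    rw [abs_mul, abs_of_pos hM]
    exact le_mul_of_one_le_right hM.le (Int.one_le_abs hx)
  refine ⟨fun v => M * (3 ^ (v : ℕ) - 3 ^ (s : ℕ)), by simp, ⟨?_, ?_⟩⟩
  · intro u v huv
    rw [← mul_sub]
    refine mul_le _ fun h => huv (Fin.ext ?_)
    apply Nat.pow_right_injective (by norm_num : 2 ≤ 3)
    simp only
    zify
    linarith
  · intro u v x y huv hxy hne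
    rw [← mul_sub, ← mul_sub, ← mul_sub]
    refine mul_le _ fun h => hne ?_
    have h' : 3 ^ (v : ℕ) + 3 ^ (x : ℕ) = 3 ^ (y : ℕ) + 3 ^ (u : ℕ) := by
      zify
      linarith
    obtain ⟨h1, h2⟩ := three_pow_add_inj (fun he => huv (Fin.ext he.symm)) h'
    rw [Fin.ext h1, Fin.ext h2]

section Supersequence

theorem map_range_sublist_range {g : ℕ → ℕ} (hg : StrictMono g) {m k : ℕ}
    (h : ∀ j < m, g j < k) : ((List.range m).map g).Sublist (List.range k) := by
  induction m generalizing k with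
  | zero => simp
  | succ m ih =>
    rw [List.range_succ, List.map_append]
    have h1 : ((List.range m).map g).Sublist (List.range (g m)) := ih fun j hj => hg hj
    have h2 := h1.append (List.Sublist.refl [g m])
    rw [← List.range_succ] at h2
    exact h2.trans (List.range_sublist.2 (h m (Nat.lt_succ_self m)))

theorem sublist_drop_of_cons_sublist {β : Type*} [DecidableEq β] {b : β} {l u : List β}
    (h : (b :: l).Sublist u) : l.Sublist (u.drop (u.idxOf b + 1)) := by
  induction u with
  | nil => simp at h
  | cons c u ih =>
    by_cases hcb : c = b
    · subst hcb
      simpa using h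
    · rw [List.idxOf_cons_ne _ hcb]
      have h' : (b :: l).Sublist u := by
        rcases List.cons_sublist_cons'.1 h with h | ⟨h, _⟩
        · exact h
        · exact absurd h.symm hcb
      simpa using ih h'

/-- A word that contains all orderings of a set of `k` letters as subsequences has length at
least `k (k + 1) / 2`. -/
theorem card_mul_succ_le_length {α β : Type*} [DecidableEq α] [DecidableEq β] {g : α → β}
    (hg : Function.Injective g) (S : Finset α) (u : List β)
    (h : ∀ l : List α, l.Nodup → l.toFinset = S → (l.map g).Sublist u) :
    S.card * (S.card + 1) ≤ 2 * u.length := by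
  induction hk : S.card generalizing S u with
  | zero => simp
  | succ k ih =>
    have hmem : ∀ a ∈ S, g a ∈ u := fun a ha =>
      (h S.toList S.nodup_toList S.toList_toFinset).subset
        (List.mem_map_of_mem (Finset.mem_toList.2 ha))
    obtain ⟨a, ha, hmax⟩ := S.exists_max_image (fun a => u.idxOf (g a))
      (Finset.card_pos.1 (by omega))
    have hidx : S.card ≤ u.idxOf (g a) + 1 := by
      rw [← Finset.card_range (u.idxOf (g a) + 1)]
      refine Finset.card_le_card_of_injOn (fun b => u.idxOf (g b)) ?_ ?_
      · intro b hb
        have := hmax b hb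
        simp only [Finset.coe_range, Set.mem_Iio]
        omega
      · intro b hb c hc hbc
        exact hg ((List.idxOf_inj (hmem b hb)).1 hbc)
    have hlt : u.idxOf (g a) < u.length := List.idxOf_lt_length_iff.2 (hmem a ha)
    have hrec := ih (S.erase a) (u.drop (u.idxOf (g a) + 1)) (fun l hl hlS => by
      refine sublist_drop_of_cons_sublist (h (a :: l) ?_ ?_)
      · refine List.nodup_cons.2 ⟨fun hal => ?_, hl⟩
        have := List.mem_toFinset.2 hal
        rw [hlS] at this
        exact Finset.notMem_erase a S this
      · rw [List.toFinset_cons, hlS, Finset.insert_erase ha])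
      (by rw [Finset.card_erase_of_mem ha, hk]; rfl)
    rw [List.length_drop] at hrec
    rw [hk] at hidx
    have : 2 * (u.length - (u.idxOf (g a) + 1)) + 2 * (k + 1) ≤ 2 * u.length := by omega
    nlinarith

end Supersequence

section Routing

open Finset in
/-- **König's edge colouring theorem**: the edges `Z` of a `k`-regular bipartite multigraph have
a proper colouring with `k` colours. -/
theorem exists_edge_coloring {ζ B : Type*} [DecidableEq ζ] [DecidableEq B] [Finite B] (k : ℕ)
    (Z : Finset ζ) (f g : ζ → B) (hf : ∀ b, #{z ∈ Z | f z = b} = k)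
    (hg : ∀ b, #{z ∈ Z | g z = b} = k) :
    ∃ κ : ζ → ℕ, (∀ z ∈ Z, κ z < k) ∧ Set.InjOn (fun z => (κ z, f z)) Z ∧
      Set.InjOn (fun z => (κ z, g z)) Z := by
  induction k generalizing Z with
  | zero =>
    have hZ : ∀ z, z ∉ Z := fun z hz => by
      have := hf (f z)
      rw [card_eq_zero, filter_eq_empty_iff] at this
      exact this hz rfl
    exact ⟨fun _ => 0, fun z hz => absurd hz (hZ z), fun z hz => absurd hz (hZ z),
      fun z hz => absurd hz (hZ z)⟩
  | succ k ih =>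
    have count : ∀ (f : ζ → B) (_ : ∀ b, #{z ∈ Z | f z = b} = k + 1) (S : Finset B),
        #{z ∈ Z | f z ∈ S} = (k + 1) * #S := by
      intro f hf S
      rw [card_eq_sum_card_fiberwise (f := f) (t := S) (fun z hz => by simpa using (by
        simpa using hz : z ∈ Z ∧ f z ∈ S).2)]
      rw [mul_comm, ← smul_eq_mul, ← sum_const]
      refine sum_congr rfl fun b hb => ?_
      rw [← hf b, filter_filter]
      congr 1
      ext z
      simp only [mem_filter]
      constructor
      · rintro ⟨h1, _, h2⟩; exact ⟨h1, h2⟩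
      · rintro ⟨h1, h2⟩; exact ⟨h1, h2 ▸ hb, h2⟩
    have hall := (Finset.all_card_le_biUnion_card_iff_exists_injective
      (fun b => ({z ∈ Z | f z = b}).image g)).1 (fun S => by
        refine Nat.le_of_mul_le_mul_left ?_ (Nat.succ_pos k)
        rw [← count f hf S, ← count g hg]
        refine card_le_card fun z hz => ?_
        simp only [mem_filter, mem_biUnion, mem_image] at hz ⊢
        exact ⟨hz.1, f z, hz.2, z, ⟨hz.1, rfl⟩, rfl⟩)
    obtain ⟨c, hc, hct⟩ := hall
    simp only [mem_image, mem_filter] at hct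
    choose τ hτ hτc using hct
    have hcs := Finite.surjective_of_injective hc
    have hcf : ∀ z, z = τ (f z) → c (f z) = g z := fun z hz => by
      rw [← hτc (f z), ← hz]
    obtain ⟨κ, hκ, hκf, hκg⟩ := ih {z ∈ Z | z ≠ τ (f z)}
      (fun b => by
        have : ({z ∈ {z ∈ Z | z ≠ τ (f z)} | f z = b}) = ({z ∈ Z | f z = b}).erase (τ b) := by
          ext z
          simp only [mem_filter, mem_erase]
          constructor
          · rintro ⟨⟨h1, h2⟩, rfl⟩; exact ⟨h2, h1, rfl⟩
          · rintro ⟨h1, h2, rfl⟩; exact ⟨⟨h2, h1⟩, rfl⟩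
        rw [this, card_erase_of_mem (mem_filter.2 (hτ b)), hf b]
        rfl)
      (fun b => by
        obtain ⟨b', rfl⟩ := hcs b
        have : ({z ∈ {z ∈ Z | z ≠ τ (f z)} | g z = c b'}) =
            ({z ∈ Z | g z = c b'}).erase (τ b') := by
          ext z
          simp only [mem_filter, mem_erase]
          constructor
          · rintro ⟨⟨h1, h2⟩, h3⟩
            refine ⟨fun h => h2 ?_, h1, h3⟩
            rw [h, (hτ b').2]
          · rintro ⟨h1, h2, h3⟩
            refine ⟨⟨h2, fun h => h1 ?_⟩, h3⟩
            have := hc ((hcf z h).trans h3)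
            rw [← this, ← h]
        rw [this, card_erase_of_mem (mem_filter.2 ⟨(hτ b').1, hτc b'⟩), hg (c b')]
        rfl)
    refine ⟨fun z => if z = τ (f z) then k else κ z, fun z hz => ?_, ?_, ?_⟩
    · simp only
      split_ifs with h
      · exact Nat.lt_succ_self k
      · exact (hκ z (mem_filter.2 ⟨hz, h⟩)).trans (Nat.lt_succ_self k)
    · intro z hz z' hz' h
      simp only [Prod.mk.injEq] at h
      obtain ⟨h1, h2⟩ := h
      by_cases hzt : z = τ (f z) <;> by_cases hzt' : z' = τ (f z')
      · rw [hzt, hzt', h2]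
      · rw [if_pos hzt, if_neg hzt'] at h1
        exact absurd (hκ z' (mem_filter.2 ⟨hz', hzt'⟩)) (by omega)
      · rw [if_neg hzt, if_pos hzt'] at h1
        exact absurd (hκ z (mem_filter.2 ⟨hz, hzt⟩)) (by omega)
      · rw [if_neg hzt, if_neg hzt'] at h1
        exact hκf (mem_filter.2 ⟨hz, hzt⟩) (mem_filter.2 ⟨hz', hzt'⟩) (Prod.ext h1 h2)
    · intro z hz z' hz' h
      simp only [Prod.mk.injEq] at h
      obtain ⟨h1, h2⟩ := h
      by_cases hzt : z = τ (f z) <;> by_cases hzt' : z' = τ (f z')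
      · have := hc ((hcf z hzt).trans (h2.trans (hcf z' hzt').symm))
        rw [hzt, hzt', this]
      · rw [if_pos hzt, if_neg hzt'] at h1
        exact absurd (hκ z' (mem_filter.2 ⟨hz', hzt'⟩)) (by omega)
      · rw [if_neg hzt, if_pos hzt'] at h1
        exact absurd (hκ z (mem_filter.2 ⟨hz, hzt⟩)) (by omega)
      · rw [if_neg hzt, if_neg hzt'] at h1
        exact hκg (mem_filter.2 ⟨hz, hzt⟩) (mem_filter.2 ⟨hz', hzt'⟩) (Prod.ext h1 h2)

open Equiv in
/-- Every permutation of a product `A × X` is the composition of three permutations of which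
the first and the last preserve the second coordinate, and the middle one preserves the first
coordinate: it is `σ = (σ μ⁻¹) (μ α⁻¹) α`. -/
theorem exists_perm_factorization {X : Type*} [Fintype X] (ρ : ℕ)
    (σ : Perm (Fin ρ × X)) : ∃ α μ : Perm (Fin ρ × X), (∀ z, (α z).2 = z.2) ∧
      (∀ z, (μ z).1 = (α z).1) ∧ ∀ z, (μ z).2 = (σ z).2 := by
  classical
  have hcard : ∀ b : X, Finset.card {z : Fin ρ × X | z.2 = b} = ρ := fun b => by
    have : ({z : Fin ρ × X | z.2 = b} : Finset _) =
        (Finset.univ : Finset (Fin ρ)).image fun a => (a, b) := by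
      ext ⟨a, x⟩
      simp [eq_comm]
    rw [this, Finset.card_image_of_injective _ fun a a' h => by simpa using h, Finset.card_univ,
      Fintype.card_fin]
  obtain ⟨κ, hκ, hf, hg⟩ := exists_edge_coloring ρ (Finset.univ : Finset (Fin ρ × X))
    (fun z => z.2) (fun z => (σ z).2) hcard (fun b => by
      refine Eq.trans ?_ (hcard b)
      refine Finset.card_bij (fun z _ => σ z) (fun z hz => by simpa using hz)
        (fun z _ z' _ h => σ.injective h) (fun z hz => ⟨σ.symm z, by simpa using hz, by simp⟩))
  have hα : Function.Injective fun z : Fin ρ × X =>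
      ((⟨κ z, hκ z (Finset.mem_univ z)⟩ : Fin ρ), z.2) := fun z z' h => by
    simp only [Prod.mk.injEq, Fin.mk.injEq] at h
    exact hf (by simp) (by simp) (Prod.ext h.1 h.2)
  have hμ : Function.Injective fun z : Fin ρ × X =>
      ((⟨κ z, hκ z (Finset.mem_univ z)⟩ : Fin ρ), (σ z).2) := fun z z' h => by
    simp only [Prod.mk.injEq, Fin.mk.injEq] at h
    exact hg (by simp) (by simp) (Prod.ext h.1 h.2)
  exact ⟨Equiv.ofBijective _ (Finite.injective_iff_bijective.1 hα),
    Equiv.ofBijective _ (Finite.injective_iff_bijective.1 hμ),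
    fun z => rfl, fun z => rfl, fun z => rfl⟩

/-- The relations `R 0, …, R (K - 1)` form a rearrangeable network on `X` with out-degrees at most
`ρ`: every permutation is routed by vertex-disjoint paths. -/
structure IsRoutingNet {X : Type*} (R : ℕ → X → X → Prop) (K ρ : ℕ) : Prop where
  degree : ∀ i x, {y | R i x y}.ncard ≤ ρ
  route : ∀ σ : Equiv.Perm X, ∃ P : ℕ → Equiv.Perm X, P 0 = 1 ∧ P K = σ ∧
    ∀ i < K, ∀ x, R i (P i x) (P (i + 1) x)

theorem isRoutingNet_complete (a ρ : ℕ) (h : a ≤ ρ) :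
    IsRoutingNet (fun _ (_ _ : Fin a) => True) 1 ρ where
  degree i x := by
    refine (Set.ncard_le_card _).trans ?_
    simpa using h
  route σ := ⟨fun i => if i = 0 then 1 else σ, by simp, by simp, fun _ _ _ => trivial⟩

theorem IsRoutingNet.prod {X : Type*} [Fintype X] {R : ℕ → X → X → Prop} {K ρ : ℕ}
    (hR : IsRoutingNet R K ρ) :
    IsRoutingNet (fun i (p q : Fin ρ × X) =>
      if i = 0 then p.2 = q.2 else if i ≤ K then p.1 = q.1 ∧ R (i - 1) p.2 q.2 else p.2 = q.2)
      (K + 2) ρ where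
  degree i p := by
    have hfib : {q : Fin ρ × X | p.2 = q.2}.ncard ≤ ρ := by
      have : {q : Fin ρ × X | p.2 = q.2} = (fun a => (a, p.2)) '' (Set.univ : Set (Fin ρ)) := by
        ext ⟨a, x⟩
        simp
      rw [this]
      refine (Set.ncard_image_le Set.finite_univ).trans ?_
      simp [Set.ncard_univ]
    by_cases h0 : i = 0
    · simpa [h0] using hfib
    · by_cases hi : i ≤ K
      · simp only [h0, hi, if_true, if_false]
        have : {q : Fin ρ × X | p.1 = q.1 ∧ R (i - 1) p.2 q.2} =
            (fun y => (p.1, y)) '' {y | R (i - 1) p.2 y} := by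
          ext ⟨a, x⟩
          simp [and_comm]
        rw [this]
        exact (Set.ncard_image_le (Set.toFinite _)).trans (hR.degree _ _)
      · simpa [h0, hi] using hfib
  route σ := by
    obtain ⟨α, μ, hα, hμα, hμσ⟩ := exists_perm_factorization ρ σ
    have hβ : ∀ z, (μ (α.symm z)).1 = z.1 := fun z => by rw [hμα, Equiv.apply_symm_apply]
    have hinj : ∀ a, Function.Injective fun x => (μ (α.symm (a, x))).2 := fun a x x' h => by
      have : μ (α.symm (a, x)) = μ (α.symm (a, x')) := Prod.ext (by rw [hβ, hβ]) h
      simpa using this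
    choose P hP0 hPK hPR using fun a =>
      hR.route (Equiv.ofBijective _ (Finite.injective_iff_bijective.1 (hinj a)))
    refine ⟨fun i => if i = 0 then 1 else if i ≤ K + 1 then
      α.trans (Equiv.prodShear (Equiv.refl _) fun a => P a (i - 1)) else σ, by simp, by simp, ?_⟩
    have hlast : ∀ z, α.trans (Equiv.prodShear (Equiv.refl _) fun a => P a K) z = μ z := by
      intro z
      refine Prod.ext ?_ ?_
      · simp [hμα]
      · simp [hPK]
    intro i hi z
    by_cases h0 : i = 0
    · subst h0
      simp [hP0, hα]
    · by_cases hiK : i ≤ K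
      · obtain ⟨i, rfl⟩ : ∃ i', i = i' + 1 := ⟨i - 1, by omega⟩
        have h1 : i + 1 ≤ K + 1 := by omega
        have h2 : i + 1 + 1 ≤ K + 1 := by omega
        simp only [h0, hiK, h1, h2, if_true, if_false, Nat.succ_ne_zero]
        refine ⟨by simp, ?_⟩
        simpa using hPR (α z).1 i (by omega) (α z).2
      · obtain rfl : i = K + 1 := by omega
        have h1 : ¬ (K + 1 + 1 ≤ K + 1) := by omega
        simp only [h0, hiK, h1, le_refl, if_true, if_false, Nat.succ_ne_zero, Nat.add_sub_cancel]
        rw [hlast, hμσ]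

theorem exists_isRoutingNet (a ρ L : ℕ) (h : a ≤ ρ) :
    ∃ (X : Type) (_ : Fintype X) (R : ℕ → X → X → Prop),
      Fintype.card X = a * ρ ^ L ∧ IsRoutingNet R (2 * L + 1) ρ := by
  induction L with
  | zero => exact ⟨Fin a, inferInstance, _, by simp, isRoutingNet_complete a ρ h⟩
  | succ L ih =>
    obtain ⟨X, _, R, hX, hR⟩ := ih
    refine ⟨Fin ρ × X, inferInstance, _, ?_, hR.prod⟩
    rw [Fintype.card_prod, hX, Fintype.card_fin, pow_succ]
    ring

end Routing

section Layered

/-- The walk that runs through the layers `0, …, K` of the routing network once for every `f j`,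
using the permutations `P i`. -/
def layeredWalk {V X : Type*} (φ : ℕ → X → V) (K : ℕ) (P : ℕ → Equiv.Perm X) (f : ℕ → X)
    (t : ℕ) : V :=
  φ (t % (K + 1)) (P (t % (K + 1)) (f (t / (K + 1))))

theorem layeredWalk_apply {V X : Type*} (φ : ℕ → X → V) {K : ℕ} (P : ℕ → Equiv.Perm X)
    (f : ℕ → X) (j : ℕ) {i : ℕ} (hi : i ≤ K) :
    layeredWalk φ K P f (j * (K + 1) + i) = φ i (P i (f j)) := by
  have h1 : (j * (K + 1) + i) % (K + 1) = i := by
    rw [add_comm, Nat.add_mul_mod_self_right, Nat.mod_eq_of_lt (by omega)]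
  have h2 : (j * (K + 1) + i) / (K + 1) = j := by
    rw [mul_comm, Nat.mul_add_div (by omega), Nat.div_eq_of_lt (by omega), add_zero]
  rw [layeredWalk, h1, h2]

variable {V X : Type*} {φ : ℕ → X → V} {K ρ : ℕ} {R : ℕ → X → X → Prop}

/-- If `w` contains all simple paths, then for every bijection `h` given by edges from layer `K`
to layer `0` it contains these edges in every order of their heads. -/
theorem sublist_of_contains_paths
    (hφ : ∀ i ≤ K, ∀ i' ≤ K, ∀ x x', φ i x = φ i' x' → i = i' ∧ x = x')
    (hR : IsRoutingNet R K ρ) {E : V → V → Prop}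
    (hRE : ∀ i < K, ∀ x y, R i x y → E (φ i x) (φ (i + 1) y))
    {h : Equiv.Perm X} (hE : ∀ x, E (φ K x) (φ 0 (h x))) {s : V} {w : List (V × V)}
    (hw : ∀ (k : ℕ) (p : ℕ → V), p 0 = s → Set.InjOn p (Set.Iic k) →
      (∀ i < k, E (p i) (p (i + 1))) →
      ((List.range k).map fun i => (p i, p (i + 1))).Sublist ((p 0, p 1) :: w))
    (hK : 1 ≤ K) {x₀ : X} (hs : φ 0 x₀ = s) {l : List X} (hl : (x₀ :: l).Nodup) :
    ∃ x y, (l.map fun z => (φ K (h.symm z), φ 0 z)).Sublist ((φ 0 x, φ 1 y) :: w) := by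
  classical
  set N := l.length with hN
  set f : ℕ → X := fun j => (x₀ :: l).getD j x₀ with hf
  have hfget : ∀ j (hj : j < (x₀ :: l).length), f j = (x₀ :: l)[j] := fun j hj => by
    simp only [hf]; exact List.getD_eq_getElem _ _ hj
  have hfinj : ∀ j ≤ N, ∀ j' ≤ N, f j = f j' → j = j' := by
    intro j hj j' hj' hjj
    rw [hfget j (by simp; omega), hfget j' (by simp; omega)] at hjj
    exact (hl.getElem_inj_iff).1 hjj
  have hform : ∀ j < N, (x₀ :: l).formPerm (f j) = f (j + 1) := fun j hj => by
    rw [hfget j (by simp; omega), hfget (j + 1) (by simp; omega)]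
    exact List.formPerm_apply_lt_getElem _ hl j (by simp; omega)
  obtain ⟨P, hP0, hPK, hPR⟩ := hR.route ((x₀ :: l).formPerm.trans h.symm)
  set p := layeredWalk φ K P f with hp
  have hpa : ∀ j i, i ≤ K → p (j * (K + 1) + i) = φ i (P i (f j)) := fun j i hi =>
    layeredWalk_apply φ P f j hi
  have hdecomp : ∀ t, ∃ j i, i ≤ K ∧ t = j * (K + 1) + i := fun t =>
    ⟨t / (K + 1), t % (K + 1), Nat.lt_succ_iff.1 (Nat.mod_lt _ (by omega)), by
      rw [mul_comm]; exact (Nat.div_add_mod _ _).symm⟩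
  have hlast : ∀ j < N, p (j * (K + 1) + K) = φ K (h.symm (f (j + 1))) := fun j hj => by
    rw [hpa j K le_rfl, hPK, Equiv.trans_apply, hform j hj]
  have hfirst : ∀ j, p (j * (K + 1)) = φ 0 (f j) := fun j => by
    have := hpa j 0 (Nat.zero_le _)
    rwa [hP0, add_zero] at this
  have hstep : ∀ j, j * (K + 1) + K + 1 = (j + 1) * (K + 1) := fun j => by ring
  have hsub := hw (N * (K + 1) + K) p (by
      have := hfirst 0
      rw [zero_mul] at this
      rw [this, ← hs]
      simp [hf]) (by
      intro t ht t' ht' htt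
      obtain ⟨j, i, hi, rfl⟩ := hdecomp t
      obtain ⟨j', i', hi', rfl⟩ := hdecomp t'
      simp only [Set.mem_Iic] at ht ht'
      rw [hpa j i hi, hpa j' i' hi'] at htt
      obtain ⟨rfl, hx⟩ := hφ i hi i' hi' _ _ htt
      have hjN : j ≤ N := by
        by_contra hc
        have : (N + 1) * (K + 1) ≤ j * (K + 1) := Nat.mul_le_mul_right _ (by omega)
        rw [← hstep] at this
        omega
      have hjN' : j' ≤ N := by
        by_contra hc
        have : (N + 1) * (K + 1) ≤ j' * (K + 1) := Nat.mul_le_mul_right _ (by omega)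
        rw [← hstep] at this
        omega
      rw [hfinj j hjN j' hjN' ((P i).injective hx)]) (by
      intro t ht
      obtain ⟨j, i, hi, rfl⟩ := hdecomp t
      rcases hi.lt_or_eq with hi | rfl
      · rw [hpa j i hi.le, add_assoc, hpa j (i + 1) hi]
        exact hRE i hi _ _ (hPR i hi _)
      · have hjN : j < N := by
          by_contra hc
          have : N * (i + 1) ≤ j * (i + 1) := Nat.mul_le_mul_right _ (by omega)
          omega
        rw [hlast j hjN, hstep, hfirst]
        simpa using hE (h.symm (f (j + 1))))
  have hp0 : p 0 = φ 0 (P 0 (f 0)) := by simpa using hpa 0 0 (Nat.zero_le _)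
  have hp1 : p 1 = φ 1 (P 1 (f 0)) := by simpa using hpa 0 1 hK
  rw [hp0, hp1] at hsub
  refine ⟨_, _, List.Sublist.trans ?_ hsub⟩
  have hmono : StrictMono fun j => j * (K + 1) + K := fun j j' hjj => by
    have : j * (K + 1) < j' * (K + 1) := Nat.mul_lt_mul_of_pos_right hjj (by omega)
    simp only
    omega
  have hsel := (map_range_sublist_range hmono (m := N) (k := N * (K + 1) + K) (fun j hj => by
    have : j * (K + 1) < N * (K + 1) := Nat.mul_lt_mul_of_pos_right hj (by omega)
    omega)).map fun i => (p i, p (i + 1))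
  convert hsel using 1
  refine List.ext_getElem (by simp [hN]) fun j hj hj' => ?_
  have hjN : j < N := by simpa using hj
  simp only [List.getElem_map, List.getElem_range]
  rw [hlast j hjN, hstep, hfirst, hfget (j + 1) (by simp; omega)]
  simp

open Classical in
/-- The edges from layer `K` to layer `0` given by one bijection occur at least
`N (N - 1) / 2` times in a word that contains all simple paths. -/
theorem card_mul_pred_le_countP [Fintype X]
    (hφ : ∀ i ≤ K, ∀ i' ≤ K, ∀ x x', φ i x = φ i' x' → i = i' ∧ x = x')
    (hR : IsRoutingNet R K ρ) {E : V → V → Prop}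
    (hRE : ∀ i < K, ∀ x y, R i x y → E (φ i x) (φ (i + 1) y))
    {h : Equiv.Perm X} (hE : ∀ x, E (φ K x) (φ 0 (h x))) {s : V} {w : List (V × V)}
    (hw : ∀ (k : ℕ) (p : ℕ → V), p 0 = s → Set.InjOn p (Set.Iic k) →
      (∀ i < k, E (p i) (p (i + 1))) →
      ((List.range k).map fun i => (p i, p (i + 1))).Sublist ((p 0, p 1) :: w))
    (hK : 1 ≤ K) {x₀ : X} (hs : φ 0 x₀ = s) :
    (Fintype.card X - 1) * Fintype.card X ≤
      2 * w.countP fun e => ∃ x, e = (φ K x, φ 0 (h x)) := by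
  set c : V × V → Bool := fun e => decide (∃ x, e = (φ K x, φ 0 (h x))) with hc
  have hinj : Function.Injective (φ 0) := fun x x' hxx =>
    (hφ 0 (Nat.zero_le _) 0 (Nat.zero_le _) x x' hxx).2
  have key := card_mul_succ_le_length hinj (Finset.univ.erase x₀) ((w.filter c).map Prod.snd)
    (fun l hl hlS => by
      have hx₀ : x₀ ∉ l := fun hm => by
        have := List.mem_toFinset.2 hm
        rw [hlS] at this
        exact Finset.notMem_erase _ _ this
      obtain ⟨x, y, hsub⟩ := sublist_of_contains_paths hφ hR hRE hE hw hK hs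
        (List.nodup_cons.2 ⟨hx₀, hl⟩)
      have hsub' := hsub.filter c
      rw [List.filter_eq_self.2 (by
        intro e he
        obtain ⟨z, _, rfl⟩ := List.mem_map.1 he
        simp only [hc, decide_eq_true_eq]
        exact ⟨h.symm z, by simp⟩)] at hsub'
      rw [List.filter_cons_of_neg (by
        simp only [hc, decide_eq_true_eq]
        rintro ⟨z, hz⟩
        have := (hφ 0 (Nat.zero_le _) K le_rfl _ _ (Prod.mk.inj hz).1).1
        omega)] at hsub'
      have := hsub'.map Prod.snd
      simpa [Function.comp_def] using this)
  rw [List.length_map, ← List.countP_eq_length_filter, Finset.card_erase_of_mem (Finset.mem_univ _),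
    Finset.card_univ] at key
  have : 1 ≤ Fintype.card X := Fintype.card_pos_iff.2 ⟨x₀⟩
  rwa [Nat.sub_add_cancel this] at key

open Classical in
theorem sum_countP_le_length {α ι : Type*} [Fintype ι] (c : ι → α → Prop)
    (hc : ∀ a i i', c i a → c i' a → i = i') (w : List α) :
    ∑ i, w.countP (fun a => c i a) ≤ w.length := by
  induction w with
  | nil => simp
  | cons a w ih =>
    simp only [List.countP_cons, Finset.sum_add_distrib, List.length_cons]
    refine Nat.add_le_add ih ?_
    have : ∑ i, (if decide (c i a) = true then 1 else 0) = Finset.card {i | c i a} := by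
      rw [Finset.card_filter]; simp
    rw [this]
    exact Finset.card_le_one.2 fun i hi i' hi' =>
      hc a i i' (by simpa using hi) (by simpa using hi')

theorem mul_card_mul_pred_le_length [Fintype X]
    (hφ : ∀ i ≤ K, ∀ i' ≤ K, ∀ x x', φ i x = φ i' x' → i = i' ∧ x = x')
    (hR : IsRoutingNet R K ρ) {E : V → V → Prop}
    (hRE : ∀ i < K, ∀ x y, R i x y → E (φ i x) (φ (i + 1) y))
    {d : ℕ} {h : Fin d → Equiv.Perm X} (hh : ∀ r r' x, h r x = h r' x → r = r')
    (hE : ∀ r x, E (φ K x) (φ 0 (h r x))) {s : V} {w : List (V × V)}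
    (hw : ∀ (k : ℕ) (p : ℕ → V), p 0 = s → Set.InjOn p (Set.Iic k) →
      (∀ i < k, E (p i) (p (i + 1))) →
      ((List.range k).map fun i => (p i, p (i + 1))).Sublist ((p 0, p 1) :: w))
    (hK : 1 ≤ K) {x₀ : X} (hs : φ 0 x₀ = s) :
    d * ((Fintype.card X - 1) * Fintype.card X) ≤ 2 * w.length := by
  classical
  have h1 : ∑ r : Fin d, w.countP (fun e => ∃ x, e = (φ K x, φ 0 (h r x))) ≤ w.length := by
    convert sum_countP_le_length (fun (r : Fin d) e => ∃ x, e = (φ K x, φ 0 (h r x))) ?_ w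
    rintro e r r' ⟨x, rfl⟩ ⟨x', hx'⟩
    obtain ⟨hx1, hx2⟩ := Prod.mk.inj hx'
    obtain rfl := (hφ K le_rfl K le_rfl _ _ hx1).2
    exact hh _ _ _ (hφ 0 (Nat.zero_le _) 0 (Nat.zero_le _) _ _ hx2).2
  have h2 : ∑ _r : Fin d, (Fintype.card X - 1) * Fintype.card X ≤
      ∑ r : Fin d, 2 * w.countP (fun e => ∃ x, e = (φ K x, φ 0 (h r x))) :=
    Finset.sum_le_sum fun r _ => by
      convert card_mul_pred_le_countP hφ hR hRE (hE r) hw hK hs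
  rw [Finset.sum_const, ← Finset.mul_sum, Finset.card_univ, Fintype.card_fin, smul_eq_mul] at h2
  omega

end Layered

theorem exists_digraph_of_edges {n m : ℕ} (S : Finset (Fin n × Fin n))
    (hS : ∀ e ∈ S, e.1 ≠ e.2) (hSm : S.card ≤ m) (hm : m ≤ n * (n - 1)) :
    ∃ G : Digraph (Fin n), (∀ v, ¬ G.Adj v v) ∧
      {e : Fin n × Fin n | G.Adj e.1 e.2}.ncard = m ∧ ∀ e ∈ S, G.Adj e.1 e.2 := by
  have hsub : S ⊆ (Finset.univ : Finset (Fin n)).offDiag := fun e he => by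
    simpa using hS e he
  obtain ⟨U, hSU, hU, hUm⟩ := Finset.exists_subsuperset_card_eq hsub hSm (by
    rw [Finset.offDiag_card, Finset.card_univ, Fintype.card_fin, ← Nat.mul_sub_one]
    exact hm)
  refine ⟨⟨fun u v => (u, v) ∈ U⟩, fun v hv => ?_, ?_, fun e he => hSU he⟩
  · have := hU hv
    simp at this
  · rw [← hUm, ← Set.ncard_coe_finset]
    rfl

theorem exists_runningTime_ge {n : ℕ} {G : Digraph (Fin n)} (hG : ∀ v, ¬ G.Adj v v)
    {s : Fin n} {T : ℕ}
    (hT : ∀ w : List (Fin n × Fin n), (∀ (k : ℕ) (p : ℕ → Fin n), p 0 = s →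
      Set.InjOn p (Set.Iic k) → (∀ i < k, G.Adj (p i) (p (i + 1))) →
      ((List.range k).map fun i => (p i, p (i + 1))).Sublist ((p 0, p 1) :: w)) →
      T ≤ 2 * w.length) {A : Algorithm G} (hA : A.Correct s) :
    ∃ ℓ, NoNegCycle G ℓ ∧ T ≤ 2 * A.runningTime s ℓ := by
  by_contra! hc
  obtain ⟨w, hw, hsub⟩ := exists_list_of_runningTime_le hG (exists_separated s) hA
    (T := (T - 1) / 2) (fun ℓ hℓ => by have := hc ℓ hℓ; omega)
  have h1 := hT w hsub
  have h2 := hc _ (noNegCycle_potWeight G (fun _ => 0) (fun _ _ => 0) fun _ _ => le_rfl)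
  omega

theorem exists_hard_digraph {n m ρ a L d : ℕ} (haρ : a ≤ ρ) (hN : 0 < a * ρ ^ L)
    (hn : (2 * L + 2) * (a * ρ ^ L) ≤ n)
    (hm : (2 * L + 1) * (a * ρ ^ L) * ρ + d * (a * ρ ^ L) ≤ m) (hd : d ≤ a * ρ ^ L)
    (hmn : m ≤ n * (n - 1)) :
    ∃ (G : Digraph (Fin n)) (s : Fin n), (∀ v, ¬ G.Adj v v) ∧
      {e : Fin n × Fin n | G.Adj e.1 e.2}.ncard = m ∧
      ∀ A : Algorithm G, A.Correct s → ∃ ℓ, NoNegCycle G ℓ ∧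
        d * ((a * ρ ^ L - 1) * (a * ρ ^ L)) ≤ 2 * A.runningTime s ℓ := by
  classical
  obtain ⟨X, _, R, hX, hR⟩ := exists_isRoutingNet a ρ L haρ
  rw [← hX] at hN hn hm hd ⊢
  set K := 2 * L + 1 with hK
  obtain ⟨emb⟩ : Nonempty (Fin (K + 1) × X ↪ Fin n) :=
    Function.Embedding.nonempty_of_card_le (by simpa [hK] using hn)
  set φ : ℕ → X → Fin n := fun i x => emb (Fin.ofNat (K + 1) i, x) with hφdef
  have hφ : ∀ i ≤ K, ∀ i' ≤ K, ∀ x x', φ i x = φ i' x' → i = i' ∧ x = x' := by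
    intro i hi i' hi' x x' h
    have h1 := Prod.mk.inj (emb.injective h)
    refine ⟨?_, h1.2⟩
    have h2 := congrArg Fin.val h1.1
    simp only [Fin.val_ofNat] at h2
    rwa [Nat.mod_eq_of_lt (by omega), Nat.mod_eq_of_lt (by omega)] at h2
  obtain ⟨x₀⟩ : Nonempty X := Fintype.card_pos_iff.1 hN
  have : NeZero (Fintype.card X) := ⟨hN.ne'⟩
  set E := Fintype.equivFin X
  set h : Fin d → Equiv.Perm X := fun r => (E.trans (Equiv.addRight (Fin.castLE hd r))).trans E.symm
    with hh
  have hhinj : ∀ r r' x, h r x = h r' x → r = r' := by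
    intro r r' x hx
    simpa [hh] using hx
  set S₁ : Finset (Fin n × Fin n) := (Finset.univ : Finset (Fin K × X)).biUnion fun ix =>
    (Finset.univ.filter fun y => R ix.1 ix.2 y).image fun y => (φ ix.1 ix.2, φ (ix.1 + 1) y)
    with hS₁
  set S₂ : Finset (Fin n × Fin n) := (Finset.univ : Finset (Fin d × X)).image fun rx =>
    (φ K rx.2, φ 0 (h rx.1 rx.2)) with hS₂
  have hc₁ : S₁.card ≤ K * Fintype.card X * ρ := by
    refine (Finset.card_biUnion_le_card_mul _ _ ρ fun ix _ => ?_).trans (by simp)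
    refine Finset.card_image_le.trans ?_
    have := hR.degree ix.1 ix.2
    rwa [← Set.ncard_coe_finset, Finset.coe_filter_univ]
  have hc₂ : S₂.card ≤ d * Fintype.card X := Finset.card_image_le.trans (by simp)
  obtain ⟨G, hG, hGm, hGS⟩ := exists_digraph_of_edges (S₁ ∪ S₂) (m := m) (by
    intro e he
    rcases Finset.mem_union.1 he with he | he
    · simp only [hS₁, Finset.mem_biUnion, Finset.mem_image] at he
      obtain ⟨ix, _, y, _, rfl⟩ := he
      intro hc
      have := (hφ _ (by omega) _ (by omega) _ _ hc).1
      omega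
    · simp only [hS₂, Finset.mem_image] at he
      obtain ⟨rx, _, rfl⟩ := he
      intro hc
      have := (hφ _ le_rfl _ (Nat.zero_le _) _ _ hc).1
      omega)
    ((Finset.card_union_le _ _).trans ((Nat.add_le_add hc₁ hc₂).trans hm)) hmn
  refine ⟨G, φ 0 x₀, hG, hGm, fun A hA => exists_runningTime_ge hG (fun w hw => ?_) hA⟩
  refine mul_card_mul_pred_le_length hφ hR (E := G.Adj) (fun i hi x y hxy => ?_) hhinj
    (fun r x => ?_) hw (by omega) rfl
  · refine hGS (φ i x, φ (i + 1) y) (Finset.mem_union_left _ ?_)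
    simp only [hS₁, Finset.mem_biUnion, Finset.mem_image]
    exact ⟨(⟨i, hi⟩, x), Finset.mem_univ _, y, by simpa using hxy, rfl⟩
  · refine hGS (φ K x, φ 0 (h r x)) (Finset.mem_union_right _ ?_)
    simp only [hS₂, Finset.mem_image]
    exact ⟨(r, x), Finset.mem_univ _, rfl⟩

theorem exists_digraph_runningTime_pos {n m : ℕ} (hn : 3 ≤ n) (hm : n ≤ m)
    (hmn : m ≤ n * (n - 1)) :
    ∃ (G : Digraph (Fin n)) (s : Fin n), (∀ v, ¬ G.Adj v v) ∧
      {e : Fin n × Fin n | G.Adj e.1 e.2}.ncard = m ∧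
      ∀ A : Algorithm G, A.Correct s → ∃ ℓ, NoNegCycle G ℓ ∧ 1 ≤ A.runningTime s ℓ := by
  set p : ℕ → Fin n := fun i => ⟨min i 2, by omega⟩ with hp
  obtain ⟨G, hG, hGm, hGS⟩ := exists_digraph_of_edges {(p 0, p 1), (p 1, p 2)} (m := m)
    (by simp [hp]) (Finset.card_le_two.trans (by omega)) hmn
  refine ⟨G, p 0, hG, hGm, fun A hA => ?_⟩
  obtain ⟨ℓ, hℓ, h⟩ := exists_runningTime_ge hG (T := 2) (fun w hw => by
    have := (hw 2 p rfl (by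
      intro i hi j hj hij
      simp only [hp, Fin.mk.injEq, Set.mem_Iic] at *
      omega) (by
      intro i hi
      interval_cases i
      · exact hGS (p 0, p 1) (by simp)
      · exact hGS (p 1, p 2) (by simp))).length_le
    simp at this
    omega) hA
  exact ⟨ℓ, hℓ, by omega⟩

theorem exists_depth {n ρ : ℕ} (hn : 8 ≤ n) (hρ : 2 ≤ ρ) :
    ∃ L, 8 * (L + 1) * ρ ^ L ≤ n ∧ n < 8 * (L + 2) * ρ ^ (L + 1) := by
  have hex : ∃ L, n < 8 * (L + 1) * ρ ^ L := by
    refine ⟨n, ?_⟩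
    have : 1 ≤ ρ ^ n := Nat.one_le_pow _ _ (by omega)
    nlinarith
  obtain ⟨L, hL⟩ : ∃ L, Nat.find hex = L + 1 := by
    refine Nat.exists_eq_succ_of_ne_zero fun h0 => ?_
    have := Nat.find_spec hex
    rw [h0] at this
    simp at this
    omega
  refine ⟨L, ?_, ?_⟩
  · have := Nat.find_min hex (m := L) (by omega)
    omega
  · have := Nat.find_spec hex
    rw [hL] at this
    exact this

theorem exists_size {n ρ : ℕ} (hn : 16 ≤ n) (hρ : 2 ≤ ρ) (hρn : ρ ≤ 2 * n) :
    ∃ a L : ℕ, a ≤ ρ ∧ ρ ^ L ≤ n ∧ 2 ≤ a * ρ ^ L ∧ 8 * (L + 1) * (a * ρ ^ L) ≤ n ∧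
      n ≤ 16 * (L + 1) * (a * ρ ^ L) ∧ ρ * (L + 1) ^ 2 ≤ 2 * n := by
  obtain ⟨L, hL1, hL2⟩ := exists_depth (n := n) (by omega) hρ
  have hpow : 1 ≤ ρ ^ L := Nat.one_le_pow _ _ (by omega)
  set c := 8 * (L + 1) * ρ ^ L with hc
  have hc0 : 0 < c := by positivity
  set a := min ρ (n / c) with ha
  have hac : 1 ≤ n / c := (Nat.le_div_iff_mul_le hc0).2 (by omega)
  have ha1 : 1 ≤ a := le_min (by omega) hac
  have haρ : a ≤ ρ := min_le_left _ _
  set N := a * ρ ^ L with hN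
  have hN0 : 0 < N := by positivity
  have hNn : 8 * (L + 1) * N ≤ n := by
    calc 8 * (L + 1) * N = c * a := by rw [hc, hN]; ring
      _ ≤ c * (n / c) := Nat.mul_le_mul_left _ (min_le_right _ _)
      _ ≤ n := Nat.mul_div_le _ _
  have hnN : n ≤ 16 * (L + 1) * N := by
    rcases min_choice ρ (n / c) with h | h
    · have : N = ρ ^ (L + 1) := by rw [hN, ha, h, pow_succ]; ring
      rw [← this] at hL2
      nlinarith
    · have h1 : n < c * (n / c + 1) := Nat.lt_mul_div_succ _ hc0
      rw [← h, ← ha] at h1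
      calc n ≤ c * (a + 1) := h1.le
        _ ≤ c * (a + a) := Nat.mul_le_mul_left _ (by omega)
        _ = 16 * (L + 1) * N := by rw [hc, hN]; ring
  have hN2 : 2 ≤ N := by
    rcases Nat.eq_zero_or_pos L with h0 | h0
    · have h8 : c = 8 := by rw [hc, h0]; simp
      rw [hN, h0, pow_zero, mul_one, ha, h8]
      exact le_min hρ (by omega)
    · calc 2 ≤ ρ ^ 1 := by simpa using hρ
        _ ≤ ρ ^ L := Nat.pow_le_pow_right (by omega) h0
        _ ≤ N := Nat.le_mul_of_pos_left _ ha1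
  have hnL : ρ * (L + 1) ^ 2 ≤ 2 * n := by
    rcases Nat.eq_zero_or_pos L with h0 | h0
    · rw [h0]; simpa using hρn
    · obtain ⟨l, rfl⟩ : ∃ l, L = l + 1 := ⟨L - 1, by omega⟩
      have h1 : l + 1 ≤ ρ ^ l := Nat.lt_pow_self (by omega)
      have h2 : 8 * (l + 1 + 1) * (ρ * (l + 1)) ≤ n := by
        refine le_trans ?_ hL1
        rw [hc, pow_succ']
        gcongr
      nlinarith [Nat.zero_le (ρ * l), Nat.zero_le (ρ * l * l)]
  exact ⟨a, L, haρ, by nlinarith, hN2, hNn, hnN, hnL⟩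

theorem exists_parameters {n m : ℕ} (hn : 16 ≤ n) (hm : n ≤ m) (hmn : m ≤ n * (n - 1)) :
    ∃ ρ a L d : ℕ, 2 ≤ ρ ∧ a ≤ ρ ∧ 0 < a * ρ ^ L ∧ (2 * L + 2) * (a * ρ ^ L) ≤ n ∧
      (2 * L + 1) * (a * ρ ^ L) * ρ + d * (a * ρ ^ L) ≤ m ∧ d ≤ a * ρ ^ L ∧
      ρ ^ L ≤ n ∧ m ≤ n * ρ ∧
      n * m ≤ 2 ^ 14 * (L + 1) * (d * ((a * ρ ^ L - 1) * (a * ρ ^ L))) := by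
  set ρ := 2 * m / n with hρdef
  have hρ1 : n * ρ ≤ 2 * m := Nat.mul_div_le _ _
  have hρ2 : 2 * m < n * (ρ + 1) := Nat.lt_mul_div_succ _ (by omega)
  have hρ : 2 ≤ ρ := (Nat.le_div_iff_mul_le (by omega)).2 (by omega)
  have hmρ : m ≤ n * ρ := by nlinarith
  have hρn : ρ ≤ 2 * n := by
    have : n * (n - 1) ≤ n * n := Nat.mul_le_mul_left _ (by omega)
    by_contra hc
    have : n * (2 * n + 1) ≤ n * ρ := Nat.mul_le_mul_left _ (by omega)
    nlinarith
  obtain ⟨a, L, haρ, hL, hN2, hNn, hnN, hnL⟩ := exists_size hn hρ hρn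
  refine ⟨ρ, a, L, min (a * ρ ^ L) (m / (2 * (a * ρ ^ L))), hρ, haρ, by omega, ?_⟩
  clear_value ρ
  generalize a * ρ ^ L = N at *
  set d := min N (m / (2 * N)) with hd
  have hdN : 2 * (d * N) ≤ m := by
    calc 2 * (d * N) = 2 * N * d := by ring
      _ ≤ 2 * N * (m / (2 * N)) := Nat.mul_le_mul_left _ (min_le_right _ _)
      _ ≤ m := Nat.mul_div_le _ _
  have h2N : 2 * N ≤ n := by nlinarith
  have hmd : m ≤ 512 * (d * N) := by
    rcases min_choice N (m / (2 * N)) with h | h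
    · have hdN : d = N := h
      rw [hdN]
      have h1 : n * n ≤ (16 * (L + 1) * N) * (16 * (L + 1) * N) := Nat.mul_le_mul hnN hnN
      have h2 : m * (L + 1) ^ 2 ≤ 2 * (n * n) := by
        calc m * (L + 1) ^ 2 ≤ n * ρ * (L + 1) ^ 2 := Nat.mul_le_mul_right _ hmρ
          _ = n * (ρ * (L + 1) ^ 2) := by ring
          _ ≤ n * (2 * n) := Nat.mul_le_mul_left _ hnL
          _ = 2 * (n * n) := by ring
      refine Nat.le_of_mul_le_mul_right (c := (L + 1) ^ 2) ?_ (by positivity)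
      calc m * (L + 1) ^ 2 ≤ 2 * (n * n) := h2
        _ ≤ 2 * ((16 * (L + 1) * N) * (16 * (L + 1) * N)) := Nat.mul_le_mul_left _ h1
        _ = _ := by ring
    · have h1 : m < 2 * N * (m / (2 * N) + 1) := Nat.lt_mul_div_succ _ (by omega)
      have h2 : 1 ≤ m / (2 * N) := (Nat.le_div_iff_mul_le (by omega)).2 (by omega)
      rw [← h, ← hd] at h1 h2
      have h3 : N * 1 ≤ N * d := Nat.mul_le_mul_left _ h2
      nlinarith
  refine ⟨?_, ?_, min_le_left _ _, hL, hmρ, ?_⟩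
  · nlinarith
  · have h1 : 4 * ((2 * L + 1) * N * ρ) ≤ 2 * m := by
      calc 4 * ((2 * L + 1) * N * ρ) = (4 * (2 * L + 1) * N) * ρ := by ring
        _ ≤ n * ρ := Nat.mul_le_mul_right _ (by nlinarith)
        _ ≤ 2 * m := hρ1
    omega
  · have h1 : N ≤ 2 * (N - 1) := by omega
    calc n * m ≤ (16 * (L + 1) * N) * (512 * (d * N)) := Nat.mul_le_mul hnN hmd
      _ ≤ (16 * (L + 1) * (2 * (N - 1))) * (512 * (d * N)) :=
        Nat.mul_le_mul_right _ (Nat.mul_le_mul_left _ h1)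
      _ = _ := by ring

theorem one_le_log {n : ℕ} (hn : 3 ≤ n) : 1 ≤ Real.log n := by
  rw [Real.le_log_iff_exp_le (by positivity)]
  have h1 : (3 : ℝ) ≤ n := by exact_mod_cast hn
  linarith [Real.exp_one_lt_d9]

theorem le_log_of_pow_le {n ρ L : ℕ} (hn : 3 ≤ n) (hρ : 2 ≤ ρ) (h : ρ ^ L ≤ n) :
    (L : ℝ) + 1 ≤ 3 * Real.log n := by
  have h1 := one_le_log hn
  have h2 : (2 : ℝ) ^ L ≤ n := by
    exact_mod_cast (Nat.pow_le_pow_left hρ L).trans h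
  have h3 := Real.log_le_log (by positivity) h2
  rw [Real.log_pow] at h3
  have h4 := Real.log_two_gt_d9
  have h5 : (0 : ℝ) ≤ L := by positivity
  nlinarith

theorem le_of_pow_le_of_rpow_le {n m ρ L : ℕ} (hn : 3 ≤ n) (hρ : 2 ≤ ρ) (h : ρ ^ L ≤ n)
    (hm : m ≤ n * ρ) {ε K : ℝ} (hε : 0 < ε) (hK : 0 < K)
    (hεK : K * (n : ℝ) ^ (1 + ε) ≤ (m : ℝ)) :
    (L : ℝ) ≤ (1 + |Real.log K| / Real.log 2) / ε := by
  have hn0 : (0 : ℝ) < n := by positivity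
  have hρ0 : (0 : ℝ) < ρ := by positivity
  have hlog2 : 0 < Real.log 2 := Real.log_pos (by norm_num)
  have h1 : K * (n : ℝ) ^ ε ≤ ρ := by
    refine le_of_mul_le_mul_left ?_ hn0
    calc (n : ℝ) * (K * (n : ℝ) ^ ε) = K * (n : ℝ) ^ (1 + ε) := by
          rw [Real.rpow_add hn0, Real.rpow_one]; ring
      _ ≤ m := hεK
      _ ≤ n * ρ := by exact_mod_cast hm
  have h2 := Real.log_le_log (by positivity) h1
  rw [Real.log_mul hK.ne' (by positivity), Real.log_rpow hn0] at h2
  have h3 : (L : ℝ) * Real.log ρ ≤ Real.log n := by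
    rw [← Real.log_pow]
    exact Real.log_le_log (by positivity) (by exact_mod_cast h)
  have h4 : Real.log 2 ≤ Real.log ρ := Real.log_le_log (by norm_num) (by exact_mod_cast hρ)
  have h5 : 0 < Real.log ρ := hlog2.trans_le h4
  have h6 : |Real.log K| ≤ |Real.log K| / Real.log 2 * Real.log ρ := by
    rw [div_mul_eq_mul_div, le_div_iff₀ hlog2]
    exact mul_le_mul_of_nonneg_left h4 (abs_nonneg _)
  rw [le_div_iff₀ hε]
  refine le_of_mul_le_mul_right ?_ h5
  have h7 := neg_abs_le (Real.log K)
  have h8 : ε * ((L : ℝ) * Real.log ρ) ≤ ε * Real.log n := mul_le_mul_of_nonneg_left h3 hε.le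
  nlinarith

end ShortestPath

theorem theorem4 :
    ∃ c : ℝ, 0 < c ∧ ∃ c' : ℝ → ℝ → ℝ, (∀ ε K : ℝ, 0 < ε → 0 < K → 0 < c' ε K) ∧
      ∀ n m : ℕ, 3 ≤ n → n ≤ m → m ≤ n * (n - 1) →
        ∃ (G : Digraph (Fin n)) (s : Fin n),
          (∀ v, ¬ G.Adj v v) ∧
          {e : Fin n × Fin n | G.Adj e.1 e.2}.ncard = m ∧
          ∀ A : ShortestPath.Algorithm G, A.Correct s →
            (∃ ℓ : Fin n → Fin n → ℤ, ShortestPath.NoNegCycle G ℓ ∧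
              c * ((n : ℝ) * (m : ℝ) / Real.log (n : ℝ)) ≤ (A.runningTime s ℓ : ℝ)) ∧
            (∀ ε K : ℝ, 0 < ε → 0 < K → K * (n : ℝ) ^ (1 + ε) ≤ (m : ℝ) →
              ∃ ℓ : Fin n → Fin n → ℤ, ShortestPath.NoNegCycle G ℓ ∧
                c' ε K * ((n : ℝ) * (m : ℝ)) ≤ (A.runningTime s ℓ : ℝ)) := by
  have hlog2 : 0 < Real.log 2 := Real.log_pos (by norm_num)
  have hpos : ∀ ε K : ℝ, 0 < ε → 0 ≤ (1 + |Real.log K| / Real.log 2) / ε := fun ε K hε => by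
    positivity
  refine ⟨1 / (3 * 2 ^ 15), by norm_num,
    fun ε K => 1 / (2 ^ 15 * ((1 + |Real.log K| / Real.log 2) / ε + 1)), fun ε K hε hK => ?_,
    fun n m hn hm hmn => ?_⟩
  · have := hpos ε K hε
    positivity
  have hlogn := ShortestPath.one_le_log hn
  rcases lt_or_ge n 16 with hn16 | hn16
  · obtain ⟨G, s, hG, hGm, hA⟩ := ShortestPath.exists_digraph_runningTime_pos hn hm hmn
    have hnm : (n : ℝ) * m ≤ 2 ^ 15 := by
      have h1 : m ≤ 15 * 14 := hmn.trans (Nat.mul_le_mul (by omega) (by omega))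
      have h2 : n * m ≤ 15 * (15 * 14) := Nat.mul_le_mul (by omega) h1
      have h3 : (n : ℝ) * m ≤ 15 * (15 * 14) := by exact_mod_cast h2
      linarith
    refine ⟨G, s, hG, hGm, fun A hAc => ?_⟩
    obtain ⟨ℓ, hℓ, ht⟩ := hA A hAc
    have ht' : (1 : ℝ) ≤ A.runningTime s ℓ := by exact_mod_cast ht
    refine ⟨⟨ℓ, hℓ, le_trans ?_ ht'⟩, fun ε K hε _ _ => ⟨ℓ, hℓ, le_trans ?_ ht'⟩⟩
    · have : (n : ℝ) * m / Real.log n ≤ n * m := div_le_self (by positivity) hlogn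
      linarith
    · have := hpos ε K hε
      rw [one_div_mul_eq_div, div_le_one (by positivity)]
      nlinarith
  · obtain ⟨ρ, a, L, d, hρ, haρ, hN, h1, h2, h3, hL, hmρ, hT⟩ :=
      ShortestPath.exists_parameters hn16 hm hmn
    obtain ⟨G, s, hG, hGm, hA⟩ := ShortestPath.exists_hard_digraph haρ hN h1 h2 h3 hmn
    refine ⟨G, s, hG, hGm, fun A hAc => ?_⟩
    obtain ⟨ℓ, hℓ, ht⟩ := hA A hAc
    have ht' : (n : ℝ) * m ≤ 2 ^ 15 * (L + 1) * A.runningTime s ℓ := by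
      have : n * m ≤ 2 ^ 15 * (L + 1) * A.runningTime s ℓ := by
        refine hT.trans ((Nat.mul_le_mul_left _ ht).trans (le_of_eq ?_))
        ring
      exact_mod_cast this
    have hrt : (0 : ℝ) ≤ A.runningTime s ℓ := by positivity
    refine ⟨⟨ℓ, hℓ, ?_⟩, fun ε K hε hK hεK => ⟨ℓ, hℓ, ?_⟩⟩
    · have hLn := ShortestPath.le_log_of_pow_le hn hρ hL
      rw [one_div_mul_eq_div, div_div, div_le_iff₀ (by positivity)]
      nlinarith [mul_le_mul_of_nonneg_right hLn hrt]
    · have hLε := ShortestPath.le_of_pow_le_of_rpow_le hn hρ hL hmρ hε hK hεK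
      have := hpos ε K hε
      rw [one_div_mul_eq_div, div_le_iff₀ (by positivity)]
      nlinarith [mul_le_mul_of_nonneg_right hLε hrt]
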